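/- Let an MV-algebra be an algebra $\langle M,\oplus,\neg,0\rangle$ of type $(2,1,0)$ satisfying $x\oplus(y\oplus z)=(x\oplus y)\oplus z$, $x\oplus y=y\oplus x$, $x\oplus 0=x$, $\neg\neg x=x$, $x\oplus\neg 0=\neg 0$ and $\neg(\neg x\oplus y)\oplus y=\neg(\neg y\oplus x)\oplus x$. Let $\mathcal{MV}_f$ be the class of finite nontrivial MV-algebras (those with more than one element). Let $C\subseteq\mathbb{R}$ be the Cantor set with the subspace topology, and consider $[0,1]^C$ with the pointwise operations $x\oplus y=\min\{x+y,1\}$, $\neg x=1-x$ and the constant $0$. Let $A\subseteq[0,1]^C$ be the set of all finite joins $\bigvee_{i=1}^n q_i\cdot 1_{U_i}$ (pointwise maxima; the empty join is $0$) with $n\ge 0$, $q_i\in[0,1]\cap\mathbb{Q}$ and $U_i\subseteq C$ clopen; $A$ is closed under the operations. Then $\mathcal{MV}_f$ is a Fraïssé class (nonempty, consisting of finitely generated structures, essentially countable, hereditary, with the joint embedding and the amalgamation property), and its Fraïssé limit is isomorphic to $A$. In detail: $A$ is a countably infinite, locally finite MV-algebra; $A$ is ultrahomogeneous (every isomorphism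 between finitely generated subalgebras of $A$ extends to an automorphism of $A$); the finitely generated structures that embed in $A$ are exactly the members of $\mathcal{MV}_f$; and a countable structure $M$ of type $(2,1,0)$ is a Fraïssé limit of $\mathcal{MV}_f$ (that is, $M$ is ultrahomogeneous and the finitely generated structures embeddable in $M$ are exactly the members of $\mathcal{MV}_f$) if and only if $M\cong A$. -/

import Mathlib

open FirstOrder FirstOrder.Language

universe u

/-- Function symbols of the signature `⟨⊕, ¬, 0⟩` of type `(2, 1, 0)`. -/
inductive MVFunc : ℕ → Type
  | oplus : MVFunc 2
  | neg : MVFunc 1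
  | zero : MVFunc 0

/-- The (purely algebraic) first-order language of MV-algebras. -/
def mvLang : FirstOrder.Language.{0, 0} := ⟨MVFunc, fun _ => Empty⟩

instance mvLang_countable : Countable (Σ l, mvLang.Functions l) := by
  have h : Function.Injective
      (fun s : (Σ l, MVFunc l) => (s.1 : ℕ)) := by
    rintro ⟨_, f⟩ ⟨_, g⟩ hfg
    cases f <;> cases g <;> simp_all
  exact h.countable

/-- `x ⊕ y` in a structure of the language of MV-algebras. -/
def mvAdd {M : Type u} [mvLang.Structure M] (x y : M) : M :=
  Structure.funMap (L := mvLang) MVFunc.oplus ![x, y]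

/-- `¬ x` in a structure of the language of MV-algebras. -/
def mvNeg {M : Type u} [mvLang.Structure M] (x : M) : M :=
  Structure.funMap (L := mvLang) MVFunc.neg ![x]

/-- The constant `0` in a structure of the language of MV-algebras. -/
def mvZero (M : Type u) [mvLang.Structure M] : M :=
  Structure.funMap (L := mvLang) MVFunc.zero ![]

/-- A structure `⟨M, ⊕, ¬, 0⟩` is an MV-algebra. -/
structure IsMVAlgebra (M : Type u) [mvLang.Structure M] : Prop where
  add_assoc : ∀ x y z : M, mvAdd x (mvAdd y z) = mvAdd (mvAdd x y) z
  add_comm : ∀ x y : M, mvAdd x y = mvAdd y x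
  add_zero : ∀ x : M, mvAdd x (mvZero M) = x
  neg_neg : ∀ x : M, mvNeg (mvNeg x) = x
  add_one : ∀ x : M, mvAdd x (mvNeg (mvZero M)) = mvNeg (mvZero M)
  lukasiewicz : ∀ x y : M,
    mvAdd (mvNeg (mvAdd (mvNeg x) y)) y = mvAdd (mvNeg (mvAdd (mvNeg y) x)) x

/-- The class of finite MV-algebras. As usual in this context an MV-algebra is nontrivial, i.e.
`0 ≠ 1`: the one-element algebra has no common extension with any other MV-algebra. -/
def finiteMVAlgebras : Set (CategoryTheory.Bundled.{u} mvLang.Structure) :=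
  {M | IsMVAlgebra M ∧ Finite M ∧ Nontrivial M}

/-- `[0,1]^X` with the pointwise operations `x ⊕ y = min (x + y) 1`, `¬ x = 1 - x`, and `0`. -/
noncomputable instance fuzzyStructure (X : Type) : mvLang.Structure (X → unitInterval) where
  funMap
    | MVFunc.oplus, v => fun x =>
        ⟨min ((v 0 x : ℝ) + v 1 x) 1,
          le_min (add_nonneg (v 0 x).2.1 (v 1 x).2.1) zero_le_one, min_le_right _ _⟩
    | MVFunc.neg, v => fun x => unitInterval.symm (v 0 x)
    | MVFunc.zero, _ => fun _ => 0
  RelMap r := Empty.elim r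

/-- The finite joins of fuzzy sets `q · 1_U`, for `q ∈ [0,1] ∩ ℚ` and `U` a clopen subset of the
Cantor set (as a subspace of `ℝ`). -/
def stepFuzzySets : Set (cantorSet → unitInterval) :=
  {f | ∃ (n : ℕ) (q : Fin n → unitInterval) (U : Fin n → Set cantorSet),
    (∀ i, (∃ r : ℚ, (q i : ℝ) = r) ∧ IsClopen (U i)) ∧
      f = Finset.univ.sup fun i => (U i).indicator fun _ => q i}

theorem mem_stepFuzzySets_iff (f : cantorSet → unitInterval) :
    f ∈ stepFuzzySets ↔ IsLocallyConstant f ∧ ∀ x, ∃ r : ℚ, (f x : ℝ) = r := by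
  classical
  constructor
  · rintro ⟨n, q, U, h, rfl⟩
    refine Finset.sup_induction
      (p := fun f : cantorSet → unitInterval =>
        IsLocallyConstant f ∧ ∀ x, ∃ r : ℚ, (f x : ℝ) = r) ?_ ?_ ?_
    · exact ⟨IsLocallyConstant.const _, fun x => ⟨0, by simp⟩⟩
    · rintro f ⟨hf, hf'⟩ g ⟨hg, hg'⟩
      refine ⟨hf.comp₂ hg (fun a b => a ⊔ b), fun x => ?_⟩
      rcases le_total (f x) (g x) with hle | hle
      · simpa [sup_eq_right.2 hle] using hg' x
      · simpa [sup_eq_left.2 hle] using hf' x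
    · intro i _
      refine ⟨?_, fun x => ?_⟩
      · refine (IsLocallyConstant.iff_exists_open _).2 fun x => ?_
        by_cases hx : x ∈ U i
        · exact ⟨U i, (h i).2.isOpen, hx, fun y hy => by simp [hx, hy]⟩
        · exact ⟨(U i)ᶜ, (h i).2.compl.isOpen, hx, fun y hy => by
            have hy' : y ∉ U i := hy
            simp [hx, hy']⟩
      · by_cases hx : x ∈ U i
        · simpa [hx] using (h i).1
        · exact ⟨0, by simp [hx]⟩
  · rintro ⟨hf, hr⟩
    have : CompactSpace cantorSet := isCompact_iff_compactSpace.1 isCompact_cantorSet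
    have hfin : (Set.range f).Finite := hf.range_finite
    have : Finite (Set.range f) := hfin
    obtain ⟨n, ⟨e⟩⟩ := Finite.exists_equiv_fin (Set.range f)
    refine ⟨n, fun i => (e.symm i : unitInterval), fun i => f ⁻¹' {(e.symm i : unitInterval)},
      fun i => ⟨?_, hf.isClopen_fiber _⟩, ?_⟩
    · obtain ⟨x, hx⟩ := (e.symm i).2
      simpa [hx] using hr x
    · funext x
      rw [Finset.sup_apply]
      apply le_antisymm
      · refine le_trans ?_ (Finset.le_sup (Finset.mem_univ (e ⟨f x, x, rfl⟩)))
        simp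
      · refine Finset.sup_le fun i _ => ?_
        by_cases hx : f x = (e.symm i : unitInterval)
        · simp [Set.indicator, hx]
        · simp [Set.indicator, hx]

/-- The algebra `A` of rational-valued clopen step functions on the Cantor set, a subalgebra of
the MV-algebra of all fuzzy subsets of the Cantor set. -/
def stepAlgebra : mvLang.Substructure (cantorSet → unitInterval) where
  carrier := stepFuzzySets
  fun_mem {n} g := by
    cases g with
    | oplus =>
      intro v hv
      obtain ⟨h0, h0'⟩ := (mem_stepFuzzySets_iff _).1 (hv 0)
      obtain ⟨h1, h1'⟩ := (mem_stepFuzzySets_iff _).1 (hv 1)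
      refine (mem_stepFuzzySets_iff _).2 ⟨?_, fun x => ?_⟩
      · exact h0.comp₂ h1 (fun a b : unitInterval =>
          (⟨min ((a : ℝ) + b) 1, le_min (add_nonneg a.2.1 b.2.1) zero_le_one,
            min_le_right _ _⟩ : unitInterval))
      · obtain ⟨r, hr⟩ := h0' x
        obtain ⟨s, hs⟩ := h1' x
        refine ⟨min (r + s) 1, ?_⟩
        change min ((v 0 x : ℝ) + v 1 x) 1 = _
        rw [hr, hs]
        push_cast
        rfl
    | neg =>
      intro v hv
      obtain ⟨h0, h0'⟩ := (mem_stepFuzzySets_iff _).1 (hv 0)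
      refine (mem_stepFuzzySets_iff _).2 ⟨h0.comp unitInterval.symm, fun x => ?_⟩
      obtain ⟨r, hr⟩ := h0' x
      refine ⟨1 - r, ?_⟩
      change 1 - (v 0 x : ℝ) = _
      rw [hr]
      push_cast
      rfl
    | zero =>
      intro v _
      refine (mem_stepFuzzySets_iff _).2 ⟨IsLocallyConstant.const (0 : unitInterval), fun x => ?_⟩
      exact ⟨0, by change ((0 : unitInterval) : ℝ) = _; simp⟩

/-! The proof is a duality argument. For finite N, an embedding of N into A is the same as a locally
constant, jointly injective family of rational homomorphisms N → [0,1] indexed by the Cantor set C.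

Two facts control these families. Rational homomorphisms separate the points of a finite MV-algebra
(`IsMVAlgebra.exists_isUnitHom_ne`): count the multiples of an atom below an element. A family that
detects 1 contains every homomorphism (`IsUnitHom.exists_eq_of_detects_one`), so all embeddings of N
have the same coordinates.

Extending an embedding of N₀ to N ⊇ N₀ therefore means lifting a locally constant map on C along the
restriction map from coordinates of N to coordinates of N₀, so that every coordinate of N is used.
This is possible because C is perfect and totally separated
(`IsLocallyConstant.exists_surjective_lift`). The extension property together with local finiteness
gives ultrahomogeneity. The age is computed directly; the Fraïssé properties of the class and
uniqueness then follow from Fraïssé's theorem. -/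

/-- A homomorphism from a structure of the language of MV-algebras to the standard MV-algebra
`[0,1]`. -/
structure IsUnitHom {M : Type u} [mvLang.Structure M] (φ : M → unitInterval) : Prop where
  map_add : ∀ x y, (φ (mvAdd x y) : ℝ) = min ((φ x : ℝ) + φ y) 1
  map_neg : ∀ x, (φ (mvNeg x) : ℝ) = 1 - φ x
  map_zero : (φ (mvZero M) : ℝ) = 0

/-! ### Multiples of an atom -/

section OrderedMonoid

variable {M : Type u} [AddCommMonoid M] [PartialOrder M] [CanonicallyOrderedAdd M] [Sub M]
  [OrderedSub M]

/-- Subtraction replaces Riesz decomposition: if t ≤ e + n • e, then t - n • e lies below both e and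
r, hence vanishes. -/
theorem le_nsmul_eq_zero_of_disjoint {e r : M} (h : ∀ t, t ≤ e → t ≤ r → t = 0) (n : ℕ) :
    ∀ t, t ≤ n • e → t ≤ r → t = 0 := by
  induction n with
  | zero => intro t ht _; simpa using ht
  | succ n ih =>
    intro t ht hr
    refine ih t ?_ hr
    rw [succ_nsmul'] at ht
    have := h (t - n • e) (by rw [tsub_le_iff_right]; exact ht) (tsub_le_self.trans hr)
    exact tsub_eq_zero_iff_le.1 this

/-- For the largest k ≤ n with k • e ≤ x, either k = n or the remainder x - k • e is disjoint from
the atom e. In the latter case it is disjoint from n • e, which bounds it, so it is zero. -/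
theorem eq_nsmul_of_le_nsmul [IsOrderedAddMonoid M] {e : M} (he : ∀ t, t ≤ e → t = 0 ∨ t = e) (n : ℕ) {x : M}
    (hx : x ≤ n • e) : ∃ k ≤ n, x = k • e := by
  classical
  set k := Nat.findGreatest (fun k => k • e ≤ x) n
  have hkx : k • e ≤ x := Nat.findGreatest_spec (P := fun k => k • e ≤ x) (Nat.zero_le n) (by simp)
  have hkn : k ≤ n := Nat.findGreatest_le n
  refine ⟨k, hkn, le_antisymm ?_ hkx⟩
  rcases hkn.eq_or_lt with h | h
  · rwa [h]
  · have hmax : ¬ (k + 1) • e ≤ x := Nat.findGreatest_is_greatest (Nat.lt_succ_self k) h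
    have hdis : ∀ t, t ≤ e → t ≤ x - k • e → t = 0 := by
      intro t ht ht'
      rcases he t ht with h0 | rfl
      · exact h0
      · refine absurd ?_ hmax
        calc (k + 1) • t = t + k • t := succ_nsmul' t k
          _ ≤ x - k • t + k • t := by gcongr
          _ = x := tsub_add_cancel_of_le hkx
    exact tsub_eq_zero_iff_le.1
      (le_nsmul_eq_zero_of_disjoint hdis n _ (tsub_le_self.trans hx) le_rfl)

/-- In a finite MV-algebra, the number of multiples of an atom below an element is, up to scaling, a
homomorphism to `[0,1]`. -/
theorem exists_height [IsOrderedAddMonoid M] [OrderTop M] [Finite M]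
    (cancel : ∀ u u' w : M, u ≤ ⊤ - w → u' ≤ ⊤ - w → u + w = u' + w → u = u')
    {a : M} (ha : a ≠ 0) :
    ∃ (n : ℕ) (v : M → ℕ), v a ≠ 0 ∧ v 0 = 0 ∧ (∀ x, v x ≤ n) ∧
      (∀ x y, v (x + y) = min (v x + v y) n) ∧ ∀ x, v (⊤ - x) + v x = n := by
  classical
  obtain ⟨e, hea, hmin⟩ := (Set.toFinite {t : M | t ≠ 0}).exists_le_minimal ha
  have he0 : e ≠ 0 := hmin.1
  have he : ∀ t, t ≤ e → t = 0 ∨ t = e := fun t ht => by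
    by_cases h : t = 0
    · exact .inl h
    · exact .inr (le_antisymm ht (hmin.2 h ht))
  have hmono : ∀ {i j : ℕ}, i ≤ j → i • e ≤ j • e := fun h => nsmul_le_nsmul_left zero_le h
  have hex : ∃ n : ℕ, n • e = (n + 1) • e := by
    by_contra! hne
    have : StrictMono fun k : ℕ => k • e :=
      strictMono_nat_of_lt_succ fun k => (hmono (Nat.le_succ k)).lt_of_ne (hne k)
    exact not_injective_infinite_finite _ this.injective
  -- The multiples of e increase strictly up to n • e and are constant afterwards; n becomes the
  -- denominator.
  set n := Nat.find hex
  have hnspec : n • e = (n + 1) • e := Nat.find_spec hex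
  have hstrict : ∀ i j, i < j → j ≤ n → ¬ j • e ≤ i • e := by
    intro i j hij hjn hle
    exact Nat.find_min hex (lt_of_lt_of_le hij hjn)
      (le_antisymm (hmono (Nat.le_succ i)) ((hmono (Nat.succ_le_of_lt hij)).trans hle))
  have hstab : ∀ m : ℕ, m • e ≤ n • e := by
    intro m
    induction m with
    | zero => simp
    | succ m ih =>
      rw [succ_nsmul, hnspec, succ_nsmul]
      gcongr
  have hle : ∀ j k, j ≤ n → j • e ≤ k • e → j ≤ k := by
    intro j k hj h
    by_contra! hlt
    exact hstrict k j hlt hj h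
  have hn1 : 1 ≤ n := by
    rw [Nat.one_le_iff_ne_zero]
    intro h0
    rw [h0] at hnspec
    exact he0 (by simpa using hnspec.symm)
  let v : M → ℕ := fun x => Nat.findGreatest (fun k => k • e ≤ x) n
  have hvn : ∀ x, v x ≤ n := fun x => Nat.findGreatest_le n
  have hvx : ∀ x, v x • e ≤ x := fun x =>
    Nat.findGreatest_spec (P := fun k => k • e ≤ x) (Nat.zero_le n) (by simp)
  have hvle : ∀ x k, k ≤ n → k • e ≤ x → k ≤ v x := fun x k hk h => Nat.le_findGreatest hk h
  have hmeet : ∀ x t, t ≤ x → t ≤ n • e → t ≤ v x • e := by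
    intro x t htx htc
    obtain ⟨k, hk, rfl⟩ := eq_nsmul_of_le_nsmul he n htc
    exact hmono (hvle x k hk htx)
  have hadd : ∀ x y, v (x + y) = min (v x + v y) n := by
    intro x y
    refine le_antisymm (le_min ?_ (hvn _)) ?_
    · refine hle _ _ (hvn _) ?_
      -- The left side lies below x and below a multiple of e, so `hmeet` applies. Swapping the
      -- subtrahends then gives the same for y.
      have h1 : v (x + y) • e - y ≤ v x • e :=
        hmeet x _ (tsub_le_iff_right.2 (hvx _)) (tsub_le_self.trans (hstab _))
      have h2 : v (x + y) • e - v x • e ≤ v y • e :=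
        hmeet y _ (tsub_le_iff_tsub_le.1 h1) (tsub_le_self.trans (hstab _))
      rw [add_nsmul]
      exact tsub_le_iff_left.1 h2
    · refine hvle _ _ (min_le_right _ _) ?_
      calc min (v x + v y) n • e ≤ (v x + v y) • e := hmono (min_le_left _ _)
        _ = v x • e + v y • e := add_nsmul _ _ _
        _ ≤ x + y := add_le_add (hvx x) (hvx y)
  refine ⟨n, v, ?_, ?_, hvn, hadd, ?_⟩
  · have := hvle a 1 hn1 (by simpa using hea)
    omega
  · have := hle (v 0) 0 (hvn 0) (by simpa using hvx 0)
    omega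
  · intro x
    have htop : v ⊤ = n := le_antisymm (hvn _) (hvle _ _ le_rfl le_top)
    have h1 := hadd (⊤ - x) x
    rw [tsub_add_cancel_of_le le_top, htop] at h1
    have h2 : n ≤ v (⊤ - x) + v x := by omega
    refine le_antisymm ?_ h2
    by_contra! hlt
    have hb1 := hvn (⊤ - x)
    have hb2 := hvn x
    set k := v x
    -- If the two heights exceeded n in total, j • e and (j + 1) • e would both lie below ⊤ - k • e
    -- and have the same sum with k • e, since n • e = (n + 1) • e. Cancellation would identify
    -- them, against the minimality of n.
    obtain ⟨j, hj⟩ : ∃ j, j + 1 + k = n + 1 := ⟨n - k, by omega⟩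
    have hje : (j + 1) • e ≤ ⊤ - k • e :=
      ((hmono (by omega : j + 1 ≤ v (⊤ - x))).trans (hvx _)).trans (tsub_le_tsub_left (hvx x) _)
    have heq : j • e + k • e = (j + 1) • e + k • e := by
      rw [← add_nsmul, ← add_nsmul, hj, show j + k = n by omega, hnspec]
    have := cancel _ _ _ ((hmono (Nat.le_succ j)).trans hje) hje heq
    exact hstrict j (j + 1) (Nat.lt_succ_self j) (by omega) this.ge

end OrderedMonoid

/-! ### Natural order and separation of points -/

namespace IsMVAlgebra

variable {M : Type u} [mvLang.Structure M]

theorem neg_add_self (h : IsMVAlgebra M) (x : M) : mvAdd (mvNeg x) x = mvNeg (mvZero M) := by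
  have := h.lukasiewicz x (mvNeg (mvZero M))
  rw [h.add_one, h.neg_neg, h.add_comm (mvZero M) x, h.add_zero] at this
  exact this.symm

theorem zero_add (h : IsMVAlgebra M) (x : M) : mvAdd (mvZero M) x = x := by
  rw [h.add_comm, h.add_zero]

theorem one_add (h : IsMVAlgebra M) (x : M) : mvAdd (mvNeg (mvZero M)) x = mvNeg (mvZero M) := by
  rw [h.add_comm, h.add_one]

theorem neg_add_eq_one_iff (h : IsMVAlgebra M) (x y : M) :
    mvAdd (mvNeg x) y = mvNeg (mvZero M) ↔ ∃ z, y = mvAdd x z := by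
  constructor
  · intro hxy
    refine ⟨mvNeg (mvAdd (mvNeg y) x), ?_⟩
    have := h.lukasiewicz x y
    rw [hxy, h.neg_neg, h.zero_add] at this
    rw [h.add_comm x, ← this]
  · rintro ⟨z, rfl⟩
    rw [h.add_assoc, h.neg_add_self, h.one_add]

/-- The additive monoid of an MV-algebra. -/
abbrev addCommMonoid (h : IsMVAlgebra M) : AddCommMonoid M where
  add := mvAdd
  zero := mvZero M
  add_assoc x y z := (h.add_assoc x y z).symm
  add_comm := h.add_comm
  zero_add := h.zero_add
  add_zero := h.add_zero
  nsmul n x := (fun y => mvAdd y x)^[n] (mvZero M)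
  nsmul_zero _ := rfl
  nsmul_succ n _ := Function.iterate_succ_apply' _ n _

/-- The natural order of an MV-algebra. -/
abbrev partialOrder (h : IsMVAlgebra M) : PartialOrder M where
  le x y := mvAdd (mvNeg x) y = mvNeg (mvZero M)
  le_refl := h.neg_add_self
  le_trans x y z hxy hyz := by
    rw [h.neg_add_eq_one_iff] at *
    obtain ⟨a, rfl⟩ := hxy
    obtain ⟨b, rfl⟩ := hyz
    exact ⟨mvAdd a b, (h.add_assoc _ _ _).symm⟩
  le_antisymm x y hxy hyx := by
    have := h.lukasiewicz x y
    rw [hxy, hyx, h.neg_neg, h.zero_add, h.zero_add] at this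
    exact this.symm

/-- Unit homomorphisms separate the points of a finite MV-algebra. -/
theorem exists_isUnitHom_ne (h : IsMVAlgebra M) [Finite M] {x y : M} (hxy : x ≠ y) :
    ∃ φ : M → unitInterval, IsUnitHom φ ∧ (∀ z, ∃ r : ℚ, (φ z : ℝ) = r) ∧ φ x ≠ φ y := by
  let _ := h.addCommMonoid
  let _ := h.partialOrder
  let _ : Sub M := ⟨fun x y => mvNeg (mvAdd (mvNeg x) y)⟩
  have le_def : ∀ a b : M, a ≤ b ↔ mvAdd (mvNeg a) b = mvNeg (mvZero M) := fun _ _ => Iff.rfl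
  have add_def : ∀ a b : M, a + b = mvAdd a b := fun _ _ => rfl
  have sub_def : ∀ a b : M, a - b = mvNeg (mvAdd (mvNeg a) b) := fun _ _ => rfl
  let _ : OrderTop M := { top := mvNeg (mvZero M), le_top := fun a => h.add_one _ }
  have top_def : (⊤ : M) = mvNeg (mvZero M) := rfl
  have top_sub : ∀ a : M, ⊤ - a = mvNeg a := fun a => by
    rw [sub_def, top_def, h.neg_neg, h.zero_add]
  have hadd : ∀ a b : M, a ≤ b → ∀ c, c + a ≤ c + b := fun a b hab c => by
    rw [le_def, h.neg_add_eq_one_iff] at *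
    obtain ⟨z, rfl⟩ := hab
    exact ⟨z, h.add_assoc _ _ _⟩
  have : IsOrderedAddMonoid M :=
    { add_le_add_left := fun a b hab c => by
        rw [_root_.add_comm a, _root_.add_comm b]; exact hadd a b hab c }
  have : CanonicallyOrderedAdd M :=
    { exists_add_of_le := fun {a b} hab => (h.neg_add_eq_one_iff a b).1 hab
      le_add_self := fun a b => (h.neg_add_eq_one_iff _ _).2 ⟨b, h.add_comm _ _⟩
      le_self_add := fun a b => (h.neg_add_eq_one_iff _ _).2 ⟨b, rfl⟩ }
  have : OrderedSub M := ⟨fun a b c => by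
    rw [le_def, le_def, sub_def, h.neg_neg, add_def, h.add_comm c b, h.add_assoc]⟩
  have cancel : ∀ u u' w : M, u ≤ ⊤ - w → u' ≤ ⊤ - w → u + w = u' + w → u = u' := by
    -- The Łukasiewicz axiom recovers u from u + w and w whenever the sum is not truncated.
    have key : ∀ u w : M, u ≤ ⊤ - w → mvAdd (mvNeg (u + w)) w = mvNeg u := fun u w huw => by
      have := h.lukasiewicz (mvNeg u) w
      rw [top_sub, le_def] at huw
      rw [h.neg_neg] at this
      rw [add_def, this, h.add_comm (mvNeg w), huw, h.neg_neg, h.zero_add]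
    intro u u' w hu hu' huu
    have := key u w hu
    rw [huu, key u' w hu'] at this
    rw [← h.neg_neg u, ← this, h.neg_neg]
  have main : ∀ a b : M, a - b ≠ 0 →
      ∃ φ : M → unitInterval, IsUnitHom φ ∧ (∀ z, ∃ r : ℚ, (φ z : ℝ) = r) ∧ φ a ≠ φ b := by
    intro a b hab
    obtain ⟨n, v, hva, hv0, hvn, hvadd, hvneg⟩ := exists_height cancel hab
    have hn : (0 : ℝ) < n := by
      have := hvn (a - b)
      exact_mod_cast (by omega : 0 < n)
    have hcoe : ∀ z, ((v z : ℝ) / n) ∈ unitInterval := fun z =>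
      ⟨by positivity, (div_le_one hn).2 (by exact_mod_cast hvn z)⟩
    have hφ : IsUnitHom fun z : M => (⟨(v z : ℝ) / n, hcoe z⟩ : unitInterval) := by
      refine ⟨fun x y => ?_, fun x => ?_, ?_⟩
      · change (v (x + y) : ℝ) / n = min ((v x : ℝ) / n + v y / n) 1
        rw [hvadd, ← add_div, ← div_self hn.ne', min_div_div_right hn.le]
        push_cast
        rfl
      · change (v (mvNeg x) : ℝ) / n = 1 - v x / n
        rw [eq_sub_iff_add_eq, ← add_div, div_eq_one_iff_eq hn.ne', ← top_sub]
        exact_mod_cast hvneg x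
      · change (v 0 : ℝ) / n = 0
        simp [hv0]
    refine ⟨_, hφ, fun z => ⟨v z / n, by push_cast; rfl⟩, fun hEq => ?_⟩
    have h1 := hφ.map_neg (mvAdd (mvNeg a) b)
    rw [hφ.map_add, hφ.map_neg a] at h1
    beta_reduce at hEq h1
    rw [hEq] at h1
    simp only [sub_add_cancel, min_self, sub_self] at h1
    have h2 : (v (a - b) : ℝ) / n = 0 := h1
    rw [div_eq_zero_iff, or_iff_left hn.ne'] at h2
    exact hva (by exact_mod_cast h2)
  by_cases hle : x - y = 0
  · have hle' : y - x ≠ 0 := fun h0 =>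
      hxy (le_antisymm (tsub_eq_zero_iff_le.1 hle) (tsub_eq_zero_iff_le.1 h0))
    obtain ⟨φ, h1, h2, h3⟩ := main y x hle'
    exact ⟨φ, h1, h2, h3.symm⟩
  · exact main x y hle

end IsMVAlgebra

/-! ### Rigidity of homomorphisms to [0,1] -/

namespace IsUnitHom

variable {M : Type u} [mvLang.Structure M] {φ ψ : M → unitInterval}

/-- The terms s ⊕ s and ¬(¬s ⊕ ¬s) act on [0,1] as min(2t, 1) and max(2t - 1, 0). Choosing by the
position of 1/2 doubles the gap until ψ reaches 1; the second term then fixes ψ at 1 and drives φ to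
0. -/
theorem exists_zero_one_of_lt (hφ : IsUnitHom φ) (hψ : IsUnitHom ψ) {s : M}
    (h : (φ s : ℝ) < ψ s) : ∃ d, (φ d : ℝ) = 0 ∧ (ψ d : ℝ) = 1 := by
  have hsq : ∀ {χ : M → unitInterval}, IsUnitHom χ → ∀ s : M,
      (χ (mvNeg (mvAdd (mvNeg s) (mvNeg s))) : ℝ) = max (2 * (χ s : ℝ) - 1) 0 := by
    intro χ hχ s
    rw [hχ.map_neg, hχ.map_add, hχ.map_neg]
    rcases le_total (2 * (χ s : ℝ) - 1) 0 with h | h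
    · rw [max_eq_right h, min_eq_right (by linarith)]; ring
    · rw [max_eq_left h, min_eq_left (by linarith)]; ring
  have stretch : ∀ (n : ℕ) (s : M), (φ s : ℝ) < 1 → (ψ s : ℝ) = 1 → 1 ≤ 2 ^ n * (1 - (φ s : ℝ)) →
      ∃ d, (φ d : ℝ) = 0 ∧ (ψ d : ℝ) = 1 := by
    intro n
    induction n with
    | zero =>
      intro s _ h1 h2
      exact ⟨s, le_antisymm (by linarith) (φ s).2.1, h1⟩
    | succ n ih =>
      intro s hlt h1 h2
      have e1 := hsq hφ s
      have e2 := hsq hψ s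
      rw [h1] at e2
      rcases le_total (2 * (φ s : ℝ) - 1) 0 with h | h
      · exact ⟨_, by rw [e1, max_eq_right h], by rw [e2]; norm_num⟩
      · rw [max_eq_left h] at e1
        refine ih _ (by rw [e1]; linarith) (by rw [e2]; norm_num) ?_
        rw [e1]
        rw [pow_succ] at h2
        linarith
  have stretch' : ∀ s : M, (φ s : ℝ) < 1 → (ψ s : ℝ) = 1 → ∃ d, (φ d : ℝ) = 0 ∧ (ψ d : ℝ) = 1 := by
    intro s h1 h2
    have hpos : 0 < 1 - (φ s : ℝ) := by linarith
    obtain ⟨n, hn⟩ := pow_unbounded_of_one_lt (1 / (1 - (φ s : ℝ))) (one_lt_two)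
    exact stretch n s h1 h2 ((div_le_iff₀ hpos).1 hn.le)
  have main : ∀ (n : ℕ) (s : M), (φ s : ℝ) < ψ s → 1 ≤ 2 ^ n * ((ψ s : ℝ) - φ s) →
      ∃ d, (φ d : ℝ) = 0 ∧ (ψ d : ℝ) = 1 := by
    intro n
    induction n with
    | zero =>
      intro s _ h2
      have h3 := (φ s).2.1
      have h4 := (ψ s).2.2
      exact ⟨s, by linarith, by linarith⟩
    | succ n ih =>
      intro s hlt h2
      rw [pow_succ] at h2
      rcases lt_or_ge (φ s : ℝ) (1 / 2) with hf | hf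
      · have e1 := hφ.map_add s s
        have e2 := hψ.map_add s s
        rw [min_eq_left (by linarith)] at e1
        rcases le_total (ψ s : ℝ) (1 / 2) with hp | hp
        · rw [min_eq_left (by linarith)] at e2
          refine ih (mvAdd s s) (by rw [e1, e2]; linarith) ?_
          rw [e1, e2]
          linarith
        · rw [min_eq_right (by linarith)] at e2
          exact stretch' _ (by rw [e1]; linarith) e2
      · have e1 := hsq hφ s
        have e2 := hsq hψ s
        rw [max_eq_left (by linarith)] at e1 e2
        refine ih _ (by rw [e1, e2]; linarith) ?_
        rw [e1, e2]
        linarith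
  have hpos : 0 < (ψ s : ℝ) - φ s := by linarith
  obtain ⟨n, hn⟩ := pow_unbounded_of_one_lt (1 / ((ψ s : ℝ) - φ s)) (one_lt_two)
  exact main n s h ((div_le_iff₀ hpos).1 hn.le)

theorem exists_zero_one (hφ : IsUnitHom φ) (hψ : IsUnitHom ψ) (h : φ ≠ ψ) :
    ∃ d, (φ d : ℝ) = 0 ∧ (ψ d : ℝ) = 1 := by
  obtain ⟨s, hs⟩ := Function.ne_iff.1 h
  rcases lt_or_gt_of_ne (fun h => hs (Subtype.ext h) : (φ s : ℝ) ≠ ψ s) with h | h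
  · exact hφ.exists_zero_one_of_lt hψ h
  · refine hφ.exists_zero_one_of_lt hψ (s := mvNeg s) ?_
    rw [hφ.map_neg, hψ.map_neg]
    linarith

/-- A family of unit homomorphisms on a finite algebra which jointly detects `1` contains every
unit homomorphism. -/
theorem exists_eq_of_detects_one [Finite M] (hφ : IsUnitHom φ) {ι : Type*}
    (ψ : ι → M → unitInterval) (hψ : ∀ i, IsUnitHom (ψ i))
    (hdet : ∀ d, (∀ i, (ψ i d : ℝ) = 1) → d = mvNeg (mvZero M)) : ∃ i, ψ i = φ := by
  classical
  by_contra! hne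
  have key : ∀ F : Finset M, (∀ d ∈ F, (φ d : ℝ) = 0) →
      ∃ d, (φ d : ℝ) = 0 ∧ ∀ i, ∀ c ∈ F, (ψ i c : ℝ) = 1 → (ψ i d : ℝ) = 1 := by
    intro F
    induction F using Finset.induction_on with
    | empty => exact fun _ => ⟨mvZero M, hφ.map_zero, by simp⟩
    | insert a F _ ih =>
      intro hF
      obtain ⟨d, h0, hd⟩ := ih fun d hd => hF d (Finset.mem_insert_of_mem hd)
      refine ⟨mvAdd a d, by rw [hφ.map_add, h0, hF a (Finset.mem_insert_self _ _)]; simp, ?_⟩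
      intro i c hc h1
      rw [(hψ i).map_add]
      have ha := (ψ i a).2.1
      have hd' := (ψ i d).2.1
      rcases Finset.mem_insert.1 hc with rfl | hc
      · exact min_eq_right (by linarith)
      · have := hd i c hc h1
        exact min_eq_right (by linarith)
  -- The sum of the whole kernel of φ is still killed by φ. If no ψ i equals φ, each ψ i sends some
  -- kernel element, hence the sum, to 1.
  obtain ⟨d, h0, hd⟩ := key (Set.toFinite {d | (φ d : ℝ) = 0}).toFinset (by simp)
  have h1 : d = mvNeg (mvZero M) := hdet d fun i => by
    obtain ⟨c, hc0, hc1⟩ := hφ.exists_zero_one (hψ i) (hne i).symm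
    exact hd i c (by simpa using hc0) hc1
  rw [h1, hφ.map_neg, hφ.map_zero] at h0
  norm_num at h0

end IsUnitHom

/-! ### Topology of the Cantor set and lifting -/

theorem neBot_nhdsWithin_natToBool (x : ℕ → Bool) : (nhdsWithin x {x}ᶜ).NeBot := by
  have ht : Filter.Tendsto (fun n => Function.update x n (!x n)) Filter.atTop (nhds x) := by
    rw [tendsto_pi_nhds]
    intro m
    refine tendsto_const_nhds.congr' ?_
    filter_upwards [Filter.eventually_gt_atTop m] with n hn
    rw [Function.update_of_ne hn.ne]
  refine Filter.Tendsto.neBot (x := Filter.atTop) (tendsto_nhdsWithin_iff.2 ⟨ht, ?_⟩)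
  refine Filter.Eventually.of_forall fun n h => ?_
  have := congrFun h n
  simp at this

instance perfectSpace_cantorSet : PerfectSpace cantorSet := by
  rw [perfectSpace_iff_forall_not_isolated]
  intro x
  have := neBot_nhdsWithin_natToBool (cantorSetHomeomorphNatToBool x)
  have h2 := cantorSetHomeomorphNatToBool.isEmbedding.map_nhdsWithin_eq {x}ᶜ x
  rw [Set.image_compl_eq cantorSetHomeomorphNatToBool.bijective, Set.image_singleton] at h2
  rw [← h2] at this
  exact Filter.map_neBot_iff _ |>.1 this

instance compactSpace_cantorSet : CompactSpace cantorSet :=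
  isCompact_iff_compactSpace.1 isCompact_cantorSet

instance totallySeparatedSpace_cantorSet : TotallySeparatedSpace cantorSet :=
  have := cantorSetHomeomorphNatToBool.symm.totallyDisconnectedSpace
  inferInstance

instance nonempty_cantorSet : Nonempty cantorSet := ⟨⟨0, zero_mem_cantorSet⟩⟩

/-- Finitely many points of a totally separated space are told apart by a locally constant map. -/
theorem exists_isLocallyConstant_injective_comp {X R : Type*} [TopologicalSpace X]
    [TotallySeparatedSpace X] [Finite R] {y : R → X} (hy : Function.Injective y) :
    ∃ δ : X → R × R → Prop, IsLocallyConstant δ ∧ Function.Injective (δ ∘ y) := by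
  classical
  have hex : ∀ p : R × R, ∃ U : Set X, IsClopen U ∧ (p.1 ≠ p.2 → y p.1 ∈ U ∧ y p.2 ∉ U) := by
    intro p
    by_cases h : p.1 = p.2
    · exact ⟨∅, isClopen_empty, fun h' => absurd h h'⟩
    · obtain ⟨U, hU, h1, h2⟩ := exists_isClopen_of_totally_separated (hy.ne h)
      exact ⟨U, hU, fun _ => ⟨h1, h2⟩⟩
  choose U hU hsep using hex
  refine ⟨fun x p => x ∈ U p, ?_, ?_⟩
  · rw [IsLocallyConstant.iff_eventually_eq]
    intro x
    have : ∀ᶠ z in nhds x, ∀ p, (z ∈ U p ↔ x ∈ U p) := by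
      rw [Filter.eventually_all]
      intro p
      by_cases hx : x ∈ U p
      · filter_upwards [(hU p).isOpen.mem_nhds hx] with z hz
        simp [hx, hz]
      · filter_upwards [(hU p).compl.isOpen.mem_nhds hx] with z hz
        simp only [hx, iff_false]
        exact hz
    filter_upwards [this] with z hz
    funext p
    exact propext (hz p)
  · intro a b hab
    by_contra hne
    have h1 := hsep (a, b) hne
    have h2 : (y a ∈ U (a, b)) = (y b ∈ U (a, b)) := congrFun hab (a, b)
    exact h1.2 (h2 ▸ h1.1)

/-- A locally constant map on a perfect totally separated space lifts to a locally constant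
surjection along every map with the same range. -/
theorem IsLocallyConstant.exists_surjective_lift {X Q R : Type*} [TopologicalSpace X]
    [PerfectSpace X] [TotallySeparatedSpace X] [Finite R] {q : X → Q} (hq : IsLocallyConstant q)
    (r : R → Q) (hr : Set.range r = Set.range q) :
    ∃ k : X → R, IsLocallyConstant k ∧ Function.Surjective k ∧ r ∘ k = q := by
  classical
  rcases isEmpty_or_nonempty R with hR | hR
  · rw [Set.range_eq_empty, eq_comm, Set.range_eq_empty_iff] at hr
    exact ⟨hr.elim, IsLocallyConstant.of_discrete _, hR.elim, funext hr.elim⟩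
  have : Nonempty X := ⟨(hr ▸ Set.mem_range_self hR.some : r hR.some ∈ Set.range q).choose⟩
  -- A nonempty open set in a perfect space is infinite, so each fibre of q has room for a distinct
  -- marked point per element of R.
  have hinf : ∀ i ∈ Set.range q, (q ⁻¹' {i}).Infinite := by
    rintro _ ⟨x, rfl⟩
    exact infinite_of_mem_nhds x ((hq.isOpen_fiber _).mem_nhds rfl)
  have hemb : ∀ i ∈ Set.range q, ∃ g : R → X, Function.Injective g ∧ ∀ a, q (g a) = i := by
    intro i hi
    have := (hinf i hi).to_subtype
    obtain ⟨n, ⟨e⟩⟩ := Finite.exists_equiv_fin R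
    let f := Infinite.natEmbedding (q ⁻¹' {i})
    exact ⟨fun a => f (e a : ℕ), fun a b h => e.injective (Fin.ext (f.injective (Subtype.ext h))),
      fun a => (f (e a : ℕ)).2⟩
  choose! g hginj hgq using hemb
  have hrq : ∀ a, r a ∈ Set.range q := fun a => hr ▸ Set.mem_range_self a
  let y : R → X := fun a => g (r a) a
  have hyq : ∀ a, q (y a) = r a := fun a => hgq (r a) (hrq a) a
  have hy : Function.Injective y := by
    intro a b hab
    have h1 : r a = r b := by rw [← hyq a, ← hyq b, hab]
    refine hginj (r a) (hrq a) ?_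
    rw [show g (r a) a = y a from rfl, hab, h1]
  obtain ⟨δ, hδ, hδy⟩ := exists_isLocallyConstant_injective_comp hy
  have hlift : ∀ x, ∃ a, r a = q x := fun x => by
    have : q x ∈ Set.range r := hr ▸ Set.mem_range_self x
    exact this
  -- A cell of (δ, q) contains at most one marked point y b. It is sent to b, which forces
  -- surjectivity; any other cell is sent to an arbitrary r-preimage of its q-value.
  have hsel : ∀ p : (R × R → Prop) × Q, ∃ a : R, p ∈ Set.range (fun x => (δ x, q x)) →
      r a = p.2 ∧ ∀ b, δ (y b) = p.1 → q (y b) = p.2 → a = b := by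
    intro p
    by_cases hp : p ∈ Set.range (fun x => (δ x, q x))
    · obtain ⟨x, rfl⟩ := hp
      by_cases hb : ∃ b, δ (y b) = δ x ∧ q (y b) = q x
      · obtain ⟨b, h1, h2⟩ := hb
        exact ⟨b, fun _ => ⟨by rw [← hyq]; exact h2, fun c hc _ => hδy (h1.trans hc.symm)⟩⟩
      · push Not at hb
        obtain ⟨a, ha⟩ := hlift x
        exact ⟨a, fun _ => ⟨ha, fun b h1 h2 => absurd h2 (hb b h1)⟩⟩
    · exact ⟨hR.some, fun h => absurd h hp⟩
  choose s hs using hsel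
  refine ⟨fun x => s (δ x, q x), (hδ.prodMk hq).comp s, fun a => ⟨y a, ?_⟩, ?_⟩
  · exact (hs _ ⟨y a, rfl⟩).2 a rfl rfl
  · funext x
    exact (hs _ ⟨x, rfl⟩).1

/-! ### Embeddings and algebras of fuzzy sets -/

section Maps

variable {M : Type*} {N : Type*} [mvLang.Structure M] [mvLang.Structure N]

theorem funMap_oplus (v : Fin 2 → M) :
    Structure.funMap (L := mvLang) MVFunc.oplus v = mvAdd (v 0) (v 1) := by
  rw [mvAdd]
  congr 1
  funext i
  fin_cases i <;> rfl

theorem funMap_neg (v : Fin 1 → M) :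
    Structure.funMap (L := mvLang) MVFunc.neg v = mvNeg (v 0) := by
  rw [mvNeg]
  congr 1
  funext i
  fin_cases i
  rfl

theorem funMap_zero (v : Fin 0 → M) :
    Structure.funMap (L := mvLang) MVFunc.zero v = mvZero M := by
  rw [mvZero]
  congr 1
  funext i
  exact i.elim0

theorem embedding_mvAdd (f : M ↪[mvLang] N) (x y : M) : f (mvAdd x y) = mvAdd (f x) (f y) :=
  (f.map_fun (L := mvLang) MVFunc.oplus ![x, y]).trans (funMap_oplus _)

theorem embedding_mvNeg (f : M ↪[mvLang] N) (x : M) : f (mvNeg x) = mvNeg (f x) :=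
  (f.map_fun (L := mvLang) MVFunc.neg ![x]).trans (funMap_neg _)

theorem embedding_mvZero (f : M ↪[mvLang] N) : f (mvZero M) = mvZero N :=
  (f.map_fun (L := mvLang) MVFunc.zero ![]).trans (funMap_zero _)

theorem IsMVAlgebra.of_embedding (h : IsMVAlgebra N) (f : M ↪[mvLang] N) : IsMVAlgebra M where
  add_assoc x y z := f.injective (by simp only [embedding_mvAdd, h.add_assoc])
  add_comm x y := f.injective (by simp only [embedding_mvAdd, h.add_comm (f x)])
  add_zero x := f.injective (by simp only [embedding_mvAdd, embedding_mvZero, h.add_zero])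
  neg_neg x := f.injective (by simp only [embedding_mvNeg, h.neg_neg])
  add_one x := f.injective (by
    simp only [embedding_mvAdd, embedding_mvNeg, embedding_mvZero, h.add_one])
  lukasiewicz x y := f.injective (by
    simp only [embedding_mvAdd, embedding_mvNeg, h.lukasiewicz (f x)])

end Maps

section Fuzzy

variable {X : Type}

theorem coe_mvAdd_apply (f g : X → unitInterval) (x : X) :
    (mvAdd f g x : ℝ) = min ((f x : ℝ) + g x) 1 := rfl

theorem coe_mvNeg_apply (f : X → unitInterval) (x : X) : (mvNeg f x : ℝ) = 1 - f x := rfl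

theorem coe_mvZero_apply (x : X) : (mvZero (X → unitInterval) x : ℝ) = 0 := rfl

theorem isMVAlgebra_fuzzy : IsMVAlgebra (X → unitInterval) where
  add_assoc f g h := by
    ext x
    have hf := (f x).2.1
    have hh := (h x).2.1
    simp only [coe_mvAdd_apply]
    rw [← min_add_add_left, ← min_add_add_right, min_assoc, min_assoc, ← add_assoc,
      min_eq_right (by linarith : (1 : ℝ) ≤ f x + 1), min_eq_right (by linarith : (1 : ℝ) ≤ 1 + h x)]
  add_comm f g := by
    ext x
    simp only [coe_mvAdd_apply, add_comm]
  add_zero f := by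
    ext x
    simp only [coe_mvAdd_apply, coe_mvZero_apply, add_zero, min_eq_left (f x).2.2]
  neg_neg f := by
    ext x
    simp only [coe_mvNeg_apply, sub_sub_cancel]
  add_one f := by
    ext x
    have hf := (f x).2.1
    simp only [coe_mvAdd_apply, coe_mvNeg_apply, coe_mvZero_apply]
    exact (min_eq_right (by linarith)).trans (by ring)
  lukasiewicz f g := by
    have key : ∀ f g : X → unitInterval, ∀ x,
        (mvAdd (mvNeg (mvAdd (mvNeg f) g)) g x : ℝ) = max (f x : ℝ) (g x) := by
      intro f g x
      have hf := (f x).2.2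
      have hg := (g x).2.2
      simp only [coe_mvAdd_apply, coe_mvNeg_apply]
      rcases le_total (f x : ℝ) (g x) with h | h
      · rw [max_eq_right h, min_eq_right (by linarith : (1 : ℝ) ≤ 1 - f x + g x), sub_self, zero_add,
          min_eq_left hg]
      · rw [max_eq_left h, min_eq_left (by linarith : (1 - f x + g x : ℝ) ≤ 1),
          min_eq_left (by linarith)]
        ring
    ext x
    rw [key, key, max_comm]

theorem isUnitHom_eval {N : Type*} [mvLang.Structure N] (f : N ↪[mvLang] (X → unitInterval))
    (x : X) : IsUnitHom fun s => f s x where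
  map_add s t := by rw [embedding_mvAdd, coe_mvAdd_apply]
  map_neg s := by rw [embedding_mvNeg, coe_mvNeg_apply]
  map_zero := by rw [embedding_mvZero, coe_mvZero_apply]

/-- There are finitely many `[0,1]`-valued functions which factor through a given map to a finite
type and whose values have a given denominator. -/
theorem finite_setOf_denominator_and_factors {ι : Type*} [Finite ι] {n : ℕ} (hn : 0 < n)
    (δ : X → ι) :
    {f : X → unitInterval | (∀ x, ∃ k : ℕ, (f x : ℝ) * n = k) ∧
      ∀ x y, δ x = δ y → f x = f y}.Finite := by
  classical
  have hn' : (0 : ℝ) < n := by exact_mod_cast hn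
  have hV : {u : unitInterval | ∃ k : ℕ, (u : ℝ) * n = k}.Finite := by
    refine Set.Finite.of_finite_image (f := fun u : unitInterval => (u : ℝ) * n)
      (((Set.finite_Iic n).image ((↑) : ℕ → ℝ)).subset ?_) ?_
    · rintro _ ⟨u, ⟨k, hk⟩, rfl⟩
      refine ⟨k, ?_, hk.symm⟩
      have := mul_le_mul_of_nonneg_right u.2.2 hn'.le
      rw [hk, one_mul] at this
      exact_mod_cast this
    · intro u _ w _ h
      exact Subtype.ext (mul_right_cancel₀ hn'.ne' h)
  let G : (X → unitInterval) → ι → unitInterval := fun f i =>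
    if h : ∃ x, δ x = i then f h.choose else 0
  have hG : ∀ f : X → unitInterval, (∀ x y, δ x = δ y → f x = f y) → ∀ x, G f (δ x) = f x := by
    intro f hf x
    have h : ∃ y, δ y = δ x := ⟨x, rfl⟩
    simp only [G, dif_pos h]
    exact hf _ _ h.choose_spec
  refine Set.Finite.of_finite_image (f := G) ((Set.Finite.pi' fun _ : ι => hV).subset ?_) ?_
  · rintro _ ⟨f, hf, rfl⟩ i
    by_cases h : ∃ x, δ x = i
    · simp only [G, dif_pos h]
      exact hf.1 _
    · simp only [G, dif_neg h]
      exact ⟨0, by simp⟩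
  · intro f hf g hg h
    funext x
    rw [← hG f hf.2 x, ← hG g hg.2 x, h]

end Fuzzy

/-! ### Cardinality and local finiteness of A -/

theorem isMVAlgebra_stepAlgebra : IsMVAlgebra stepAlgebra :=
  isMVAlgebra_fuzzy.of_embedding stepAlgebra.subtype

instance infinite_stepAlgebra : Infinite stepAlgebra := by
  have hmem : ∀ n : ℕ, (1 / ((n : ℝ) + 1)) ∈ unitInterval := fun n =>
    ⟨by positivity, (div_le_one (by positivity)).2 (by linarith [(Nat.cast_nonneg n : (0 : ℝ) ≤ n)])⟩
  let c : ℕ → stepAlgebra := fun n => ⟨fun _ => ⟨1 / ((n : ℝ) + 1), hmem n⟩,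
    (mem_stepFuzzySets_iff _).2 ⟨IsLocallyConstant.const _, fun _ => ⟨1 / (n + 1), by simp⟩⟩⟩
  refine Infinite.of_injective c fun m n h => ?_
  have h1 : (1 / ((m : ℝ) + 1)) = 1 / (n + 1) :=
    congrArg Subtype.val (congrFun (congrArg Subtype.val h) (Classical.arbitrary cantorSet))
  have h2 := Nat.cast_add_one_ne_zero (R := ℝ) m
  have h3 := Nat.cast_add_one_ne_zero (R := ℝ) n
  field_simp at h1
  exact_mod_cast (by linarith : (m : ℝ) = n)

instance countable_stepAlgebra : Countable stepAlgebra := by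
  have : Countable (TopologicalSpace.Clopens cantorSet) :=
    TopologicalSpace.Clopens.countable_iff_secondCountable.2 inferInstance
  let Q := {q : unitInterval // ∃ r : ℚ, (q : ℝ) = r}
  have : Countable Q := by
    refine Function.Injective.countable (f := fun q : Q => q.2.choose) fun a b h => ?_
    refine Subtype.ext (Subtype.ext ?_)
    rw [a.2.choose_spec, b.2.choose_spec]
    exact congrArg _ h
  let F : (Σ n : ℕ, (Fin n → Q) × (Fin n → TopologicalSpace.Clopens cantorSet)) →
      cantorSet → unitInterval := fun p =>
    Finset.univ.sup fun i => (p.2.2 i : Set cantorSet).indicator fun _ => (p.2.1 i : unitInterval)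
  have hsub : stepFuzzySets ⊆ Set.range F := by
    rintro f ⟨n, q, U, h, rfl⟩
    exact ⟨⟨n, fun i => ⟨q i, (h i).1⟩, fun i => ⟨U i, (h i).2⟩⟩, rfl⟩
  exact ((Set.countable_range F).mono hsub).to_subtype

/-- Finitely many nonnegative rational numbers have a common denominator. -/
theorem exists_common_denominator {V : Set unitInterval} (hV : V.Finite)
    (hr : ∀ u ∈ V, ∃ r : ℚ, (u : ℝ) = r) :
    ∃ n : ℕ, 0 < n ∧ ∀ u ∈ V, ∃ k : ℕ, (u : ℝ) * n = k := by
  induction V, hV using Set.Finite.induction_on with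
  | empty => exact ⟨1, one_pos, by simp⟩
  | @insert a V _ _ ih =>
    obtain ⟨n, hn, h⟩ := ih fun u hu => hr u (Set.mem_insert_of_mem _ hu)
    obtain ⟨r, hra⟩ := hr a (Set.mem_insert _ _)
    have hr0 : 0 ≤ r := by
      have := a.2.1
      rw [hra] at this
      exact_mod_cast this
    refine ⟨r.den * n, Nat.mul_pos r.den_pos hn, ?_⟩
    rintro u (rfl | hu)
    · refine ⟨r.num.toNat * n, ?_⟩
      have h1 : (r.num.toNat : ℤ) = r.num := Int.toNat_of_nonneg (Rat.num_nonneg.2 hr0)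
      have h2 : (r : ℝ) * r.den = r.num.toNat := by
        rw [← Int.cast_natCast (R := ℝ) r.num.toNat, h1]
        exact_mod_cast Rat.mul_den_eq_num r
      rw [hra]
      push_cast
      rw [← mul_assoc, h2]
    · obtain ⟨k, hk⟩ := h u hu
      refine ⟨r.den * k, ?_⟩
      push_cast
      rw [← hk]
      ring

/-- The generators take finitely many rational values, with a common denominator n, and have
finitely many joint level sets. Functions with denominator n that are constant on these sets form a
finite subalgebra. -/
theorem finite_of_fg_stepAlgebra (S : mvLang.Substructure stepAlgebra) (hS : S.FG) : Finite S := by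
  classical
  obtain ⟨F, rfl⟩ := hS
  have hmem := fun a : stepAlgebra => (mem_stepFuzzySets_iff _).1 a.2
  obtain ⟨n, hn, hden⟩ := exists_common_denominator
    (V := ⋃ a ∈ F, Set.range (a : cantorSet → unitInterval))
    (F.finite_toSet.biUnion fun a _ => (hmem a).1.range_finite) (by
      intro u hu
      simp only [Set.mem_iUnion] at hu
      obtain ⟨a, _, x, rfl⟩ := hu
      exact (hmem a).2 x)
  let δ : cantorSet → F → unitInterval := fun x a => (a.1 : cantorSet → unitInterval) x
  have hδ : IsLocallyConstant δ := by
    rw [IsLocallyConstant.iff_eventually_eq]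
    intro x
    filter_upwards [Filter.eventually_all.2 fun a : F => (hmem a.1).1.eventually_eq x] with y hy
    exact funext hy
  have hfin : Finite (Set.range δ) := hδ.range_finite
  let T : Set (cantorSet → unitInterval) := {f | (∀ x, ∃ k : ℕ, (f x : ℝ) * n = k) ∧
    ∀ x y, Set.rangeFactorization δ x = Set.rangeFactorization δ y → f x = f y}
  have hT : T.Finite := finite_setOf_denominator_and_factors hn (Set.rangeFactorization δ)
  let B : mvLang.Substructure (cantorSet → unitInterval) :=
    { carrier := T
      fun_mem := by
        intro m g v hv
        cases g with
        | oplus =>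
          refine ⟨fun x => ?_, fun x y h => ?_⟩
          · obtain ⟨k, hk⟩ := (hv 0).1 x
            obtain ⟨l, hl⟩ := (hv 1).1 x
            refine ⟨min (k + l) n, ?_⟩
            change min ((v 0 x : ℝ) + v 1 x) 1 * n = _
            rw [min_mul_of_nonneg _ _ (Nat.cast_nonneg n), add_mul, hk, hl, one_mul]
            push_cast
            rfl
          · refine Subtype.ext ?_
            change min ((v 0 x : ℝ) + v 1 x) 1 = min ((v 0 y : ℝ) + v 1 y) 1
            rw [(hv 0).2 x y h, (hv 1).2 x y h]
        | neg =>
          refine ⟨fun x => ?_, fun x y h => ?_⟩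
          · obtain ⟨k, hk⟩ := (hv 0).1 x
            have hkn : k ≤ n := by
              have := mul_le_mul_of_nonneg_right (v 0 x).2.2 (Nat.cast_nonneg (α := ℝ) n)
              rw [hk, one_mul] at this
              exact_mod_cast this
            refine ⟨n - k, ?_⟩
            change (1 - (v 0 x : ℝ)) * n = _
            rw [sub_mul, hk, one_mul, Nat.cast_sub hkn]
          · refine Subtype.ext ?_
            change 1 - (v 0 x : ℝ) = 1 - v 0 y
            rw [(hv 0).2 x y h]
        | zero =>
          refine ⟨fun x => ⟨0, ?_⟩, fun x y _ => rfl⟩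
          change ((0 : unitInterval) : ℝ) * n = _
          simp }
  have hle : Substructure.closure mvLang (F : Set stepAlgebra) ≤
      B.comap stepAlgebra.subtype.toHom := by
    rw [Substructure.closure_le]
    intro a ha
    refine ⟨fun x => hden _ ?_, fun x y h => ?_⟩
    · simp only [Set.mem_iUnion]
      exact ⟨a, ha, x, rfl⟩
    · exact congrFun (congrArg Subtype.val h) ⟨a, ha⟩
  have hB : (Subtype.val ⁻¹' T : Set stepAlgebra).Finite :=
    hT.preimage Subtype.val_injective.injOn
  exact (hB.subset hle).to_subtype

/-! ### Embeddings into A as families of homomorphisms -/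

section Embeddings

variable {N : Type*} [mvLang.Structure N]

/-- A jointly injective, locally constant family of rational unit homomorphisms indexed by the
Cantor set is an embedding into the algebra of step functions. -/
theorem exists_embedding_stepAlgebra (k : cantorSet → N → unitInterval)
    (hk : IsLocallyConstant k) (hom : ∀ y, IsUnitHom (k y))
    (hrat : ∀ y s, ∃ r : ℚ, (k y s : ℝ) = r) (hinj : ∀ s t, (∀ y, k y s = k y t) → s = t) :
    ∃ f : N ↪[mvLang] stepAlgebra, ∀ s y, (f s : cantorSet → unitInterval) y = k y s := by
  let f : N → stepAlgebra := fun s => ⟨fun y => k y s,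
    (mem_stepFuzzySets_iff _).2 ⟨hk.comp fun g => g s, fun y => hrat y s⟩⟩
  refine ⟨⟨⟨f, fun s t h => hinj s t fun y => congrFun (congrArg Subtype.val h) y⟩, ?_, ?_⟩,
    fun _ _ => rfl⟩
  · intro n g v
    refine stepAlgebra.subtype.injective ?_
    rw [stepAlgebra.subtype.map_fun]
    funext y
    refine Subtype.ext ?_
    cases g with
    | oplus =>
      erw [funMap_oplus, funMap_oplus]
      exact (hom y).map_add _ _
    | neg =>
      erw [funMap_neg, funMap_neg]
      exact (hom y).map_neg _
    | zero =>
      erw [funMap_zero, funMap_zero]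
      exact (hom y).map_zero
  · intro n r
    exact Empty.elim r

theorem isLocallyConstant_eval [Finite N] (f : N ↪[mvLang] stepAlgebra) :
    IsLocallyConstant fun x s => (f s : cantorSet → unitInterval) x := by
  rw [IsLocallyConstant.iff_eventually_eq]
  intro x
  have : ∀ᶠ y in nhds x, ∀ s, (f s : cantorSet → unitInterval) y = (f s : _ → _) x :=
    Filter.eventually_all.2 fun s =>
      ((mem_stepFuzzySets_iff _).1 (f s).2).1.eventually_eq x
  filter_upwards [this] with y hy
  exact funext hy

/-- The coordinates of f detect 1 because f is injective, so they exhaust all homomorphisms,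
including the coordinates of g. -/
theorem exists_eval_eq [Finite N] (f g : N ↪[mvLang] stepAlgebra) (x : cantorSet) :
    ∃ y, (fun s => (f s : cantorSet → unitInterval) y) = fun s => (g s : _ → _) x := by
  refine (isUnitHom_eval (stepAlgebra.subtype.comp g) x).exists_eq_of_detects_one
    (fun y s => (f s : cantorSet → unitInterval) y)
    (fun y => isUnitHom_eval (stepAlgebra.subtype.comp f) y) fun d hd => ?_
  refine (stepAlgebra.subtype.comp f).injective ?_
  funext y
  refine Subtype.ext ?_
  rw [embedding_mvNeg, coe_mvNeg_apply, embedding_mvZero, coe_mvZero_apply, sub_zero]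
  exact hd y

/-- Here j only supplies the finite set of coordinates of N; f' rearranges them over C so that they
restrict to those of f. -/
theorem exists_embedding_extension {N₀ : Type*} [mvLang.Structure N₀] [Finite N₀] [Finite N]
    (i : N₀ ↪[mvLang] N) (j : N ↪[mvLang] stepAlgebra) (f : N₀ ↪[mvLang] stepAlgebra) :
    ∃ f' : N ↪[mvLang] stepAlgebra, f = f'.comp i := by
  let p : cantorSet → N → unitInterval := fun x s => (j s : cantorSet → unitInterval) x
  let q : cantorSet → N₀ → unitInterval := fun x s => (f s : cantorSet → unitInterval) x
  have hfin : Finite (Set.range p) := (isLocallyConstant_eval j).range_finite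
  let r : Set.range p → N₀ → unitInterval := fun ρ s => ρ.1 (i s)
  have hr : Set.range r = Set.range q := by
    apply Set.Subset.antisymm
    · rintro _ ⟨⟨_, x, rfl⟩, rfl⟩
      exact exists_eval_eq f (j.comp i) x
    · rintro _ ⟨y, rfl⟩
      obtain ⟨x, hx⟩ := exists_eval_eq (j.comp i) f y
      exact ⟨⟨p x, x, rfl⟩, hx⟩
  obtain ⟨k, hk, hsurj, hrk⟩ := (isLocallyConstant_eval f).exists_surjective_lift r hr
  obtain ⟨f', hf'⟩ := exists_embedding_stepAlgebra (fun y => (k y).1) (hk.comp Subtype.val)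
    (fun y => by
      obtain ⟨x, hx⟩ := (k y).2
      rw [← hx]
      exact isUnitHom_eval (stepAlgebra.subtype.comp j) x)
    (fun y s => by
      obtain ⟨x, hx⟩ := (k y).2
      rw [← hx]
      exact ((mem_stepFuzzySets_iff _).1 (j s).2).2 x)
    -- Surjectivity of k means that every coordinate of j occurs in f', so f' inherits injectivity.
    (fun s t h => j.injective (Subtype.ext (funext fun x => by
      obtain ⟨y, hy⟩ := hsurj ⟨p x, x, rfl⟩
      have := h y
      rw [hy] at this
      exact this)))
  refine ⟨f', ?_⟩
  refine Embedding.ext fun s => Subtype.ext (funext fun y => ?_)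
  rw [Embedding.comp_apply, hf']
  exact (congrFun (congrFun hrk y) s).symm

/-- Spread one separating homomorphism for each pair of distinct elements over C. Nontriviality
provides at least one such pair, needed since C is nonempty. -/
theorem IsMVAlgebra.nonempty_embedding_stepAlgebra (h : IsMVAlgebra N) [Finite N] [Nontrivial N] :
    Nonempty (N ↪[mvLang] stepAlgebra) := by
  let R := {p : N × N // p.1 ≠ p.2}
  have hR : Nonempty R := by
    obtain ⟨a, b, hab⟩ := exists_pair_ne N
    exact ⟨⟨(a, b), hab⟩⟩
  choose φ hφ hrat hne using fun p : R => h.exists_isUnitHom_ne p.2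
  obtain ⟨k, hk, hsurj, -⟩ := (IsLocallyConstant.const (X := cantorSet) ()).exists_surjective_lift
    (fun _ : R => ()) (Set.range_const.trans Set.range_const.symm)
  obtain ⟨f, -⟩ := exists_embedding_stepAlgebra (fun y => φ (k y)) (hk.comp φ)
    (fun y => hφ (k y)) (fun y => hrat (k y)) fun s t hst => by
      by_contra hne'
      obtain ⟨y, hy⟩ := hsurj ⟨(s, t), hne'⟩
      have := hst y
      rw [hy] at this
      exact hne _ this
  exact ⟨f⟩

theorem fg_and_nonempty_embedding_stepAlgebra_iff :
    Structure.FG mvLang N ∧ Nonempty (N ↪[mvLang] stepAlgebra) ↔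
      IsMVAlgebra N ∧ Finite N ∧ Nontrivial N := by
  constructor
  · rintro ⟨hN, ⟨f⟩⟩
    have := finite_of_fg_stepAlgebra _ (hN.range f.toHom)
    refine ⟨isMVAlgebra_stepAlgebra.of_embedding f, Finite.of_equiv _ f.equivRange.symm.toEquiv,
      mvZero N, mvNeg (mvZero N), fun h => ?_⟩
    have h1 := congrArg (stepAlgebra.subtype.comp f) h
    rw [embedding_mvNeg, embedding_mvZero] at h1
    have h2 := congrArg Subtype.val (congrFun h1 (Classical.arbitrary cantorSet))
    rw [coe_mvNeg_apply, coe_mvZero_apply] at h2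
    norm_num at h2
  · rintro ⟨h, h1, h2⟩
    exact ⟨Structure.FG.of_finite, h.nonempty_embedding_stepAlgebra⟩

end Embeddings

/-! ### The Fraïssé limit -/

theorem isFraisseLimit_of_equiv_stepAlgebra {M : Type u} [mvLang.Structure M] [Countable M]
    (e : M ≃[mvLang] stepAlgebra) : IsFraisseLimit finiteMVAlgebras.{u} M where
  ultrahomogeneous := by
    rw [isUltrahomogeneous_iff_IsExtensionPair Structure.cg_of_countable,
      isExtensionPair_iff_exists_embedding_closure_singleton_sup]
    intro S hS f m
    have hfin : ∀ T : mvLang.Substructure M, T.FG → Finite T := fun T hT =>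
      (fg_and_nonempty_embedding_stepAlgebra_iff.1 ⟨(Substructure.fg_iff_structure_fg T).1 hT,
        ⟨e.toEmbedding.comp T.subtype⟩⟩).2.1
    have := hfin S hS
    have := hfin (Substructure.closure mvLang {m} ⊔ S)
      ((Substructure.fg_closure_singleton m).sup hS)
    obtain ⟨f', hf'⟩ := exists_embedding_extension
      (Substructure.inclusion (le_sup_right : S ≤ Substructure.closure mvLang {m} ⊔ S))
      (e.toEmbedding.comp (Substructure.subtype _)) (e.toEmbedding.comp f)
    refine ⟨e.symm.toEmbedding.comp f', ?_⟩
    rw [Embedding.comp_assoc, ← hf']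
    ext s
    exact (e.symm_apply_apply _).symm
  age := by
    ext N
    refine Iff.trans (and_congr_right fun _ => ?_) fg_and_nonempty_embedding_stepAlgebra_iff
    exact ⟨fun ⟨f⟩ => ⟨e.toEmbedding.comp f⟩, fun ⟨f⟩ => ⟨e.symm.toEmbedding.comp f⟩⟩

theorem theorem4p9 :
    IsFraisse finiteMVAlgebras.{u} ∧
    IsMVAlgebra stepAlgebra ∧
    Infinite stepAlgebra ∧
    (∀ S : mvLang.Substructure stepAlgebra, S.FG → Finite S) ∧
    (∃ _ : Countable stepAlgebra, IsFraisseLimit finiteMVAlgebras.{0} stepAlgebra) ∧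
    (∀ (M : Type u) [mvLang.Structure M] [Countable M],
      IsFraisseLimit finiteMVAlgebras.{u} M ↔ Nonempty (M ≃[mvLang] stepAlgebra)) := by
  -- Uniqueness compares limits in one universe, so A is lifted to universe u.
  let _ : mvLang.Structure (ULift.{u} stepAlgebra) :=
    Equiv.inducedStructure (L := mvLang) (_root_.Equiv.ulift.{u} (α := stepAlgebra)).symm
  let e : ULift.{u} stepAlgebra ≃[mvLang] stepAlgebra :=
    (Equiv.inducedStructureEquiv (L := mvLang)
      (_root_.Equiv.ulift.{u} (α := stepAlgebra)).symm).symm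
  have hlim := isFraisseLimit_of_equiv_stepAlgebra e
  refine ⟨hlim.isFraisse, isMVAlgebra_stepAlgebra, infinite_stepAlgebra,
    finite_of_fg_stepAlgebra, ⟨countable_stepAlgebra,
      isFraisseLimit_of_equiv_stepAlgebra (FirstOrder.Language.Equiv.refl mvLang stepAlgebra)⟩, ?_⟩
  intro M _ _
  refine ⟨fun hM => ?_, fun ⟨e'⟩ => isFraisseLimit_of_equiv_stepAlgebra e'⟩
  obtain ⟨g⟩ := hM.nonempty_equiv hlim
  exact ⟨e.comp g⟩
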